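/- Let $n\ge 2$ and let $x^i_j$ ($1\le i,j\le n$) be the coordinates on the space $\mathrm{Mat}_n(\mathbb C)$ of complex $n\times n$ matrices. The $1$-rigidity of a matrix $M$ is the smallest $s$ such that $M=A+B$ with $\operatorname{rank} A\le 1$ and $B$ having exactly $s$ nonzero entries. Let $\mathcal R[n,1,n^2-2n]\subset \mathrm{Mat}_n(\mathbb C)$ be the Zariski closure of the set of matrices of $1$-rigidity at most $n^2-2n$. Then the number of irreducible components of $\mathcal R[n,1,n^2-2n]$ equals the number of cycles of the complete bipartite graph $K_{n,n}$ (cycles being regarded as subgraphs), and the ideal of every irreducible component is generated by a binomial $$x^{i_1}_{j_1}\cdots x^{i_k}_{j_k}-x^{i_1}_{j_{\tau(1)}}\cdots x^{i_k}_{j_{\tau(k)}},$$ for some $k$, where $i_1,\dots,i_k\in\{1,\dots,n\}$ are distinct, $j_1,\dots,j_k\in\{1,\dots,n\}$ are distinct, and $\tau\in\mathfrak S_k$ is a $k$-cycle. More precisely, there is a bijection from the cycles of $K_{n,n}$ to the irreducible components such that, if $C$ is a cycle, then the ideal of the corresponding component is generated by such a binomial for which the edges of $C$ are exactly the edges joining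 row $i_a$ to column $j_a$ and row $i_a$ to column $j_{\tau(a)}$, $1\le a\le k$. -/

import Mathlib

namespace Rigidity

/-- The affine space of complex `n × n` matrices. -/
abbrev Mat (n : ℕ) : Type := Matrix (Fin n) (Fin n) ℂ

/-- Polynomials in the coordinates `x (i, j)` on the space of `n × n` matrices. -/
abbrev Poly (n : ℕ) : Type := MvPolynomial (Fin n × Fin n) ℂ

/-- The value of the polynomial `P` at the matrix `M`: substitute `M i j` for `x (i, j)`. -/
noncomputable def evalAt {n : ℕ} (M : Mat n) (P : Poly n) : ℂ :=
  MvPolynomial.eval (fun p : Fin n × Fin n => M p.1 p.2) P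

/-- `HasDecomposition r M s`: `M = A + B` where `A` has rank at most `r` and `B` has exactly
`s` nonzero entries. -/
def HasDecomposition {n : ℕ} (r : ℕ) (M : Mat n) (s : ℕ) : Prop :=
  ∃ A B : Mat n, M = A + B ∧ A.rank ≤ r ∧ {p : Fin n × Fin n | B p.1 p.2 ≠ 0}.ncard = s

/-- Every matrix has some decomposition, so the infimum below is a minimum. -/
theorem exists_hasDecomposition {n : ℕ} (r : ℕ) (M : Mat n) : ∃ s, HasDecomposition r M s :=
  ⟨_, 0, M, by simp, by simp, rfl⟩

/-- The `r`-rigidity of `M`: the smallest `s` such that `M = A + B` where `A` has rank at most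
`r` and `B` has exactly `s` nonzero entries. -/
noncomputable def rig {n : ℕ} (r : ℕ) (M : Mat n) : ℕ :=
  sInf {s | HasDecomposition r M s}

/-- The set of `n × n` matrices of `r`-rigidity at most `s`. -/
def rigiditySet (n r s : ℕ) : Set (Mat n) := {M | rig r M ≤ s}

/-- The ideal of all polynomials vanishing on a set of matrices. -/
noncomputable def idealOf {n : ℕ} (X : Set (Mat n)) : Ideal (Poly n) :=
  MvPolynomial.vanishingIdeal ℂ ((fun (M : Mat n) (p : Fin n × Fin n) => M p.1 p.2) '' X)

theorem mem_idealOf {n : ℕ} (X : Set (Mat n)) (P : Poly n) :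
    P ∈ idealOf X ↔ ∀ M ∈ X, evalAt M P = 0 := by
  simp [idealOf, evalAt, MvPolynomial.aeval_eq_eval]

/-- The common zero set of a set of polynomials. -/
def zeroSet {n : ℕ} (T : Set (Poly n)) : Set (Mat n) := {M | ∀ P ∈ T, evalAt M P = 0}

/-- The variety of matrices of `r`-border rigidity at most `s`: the common zero set of all
polynomials vanishing on the set of matrices of `r`-rigidity at most `s`. -/
def borderRigidityVariety (n r s : ℕ) : Set (Mat n) :=
  zeroSet (idealOf (rigiditySet n r s) : Set (Poly n))

/-- The Zariski topology on the space of matrices: the closed sets are the common zero sets of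
sets of polynomials. -/
abbrev zariski (n : ℕ) : TopologicalSpace (Mat n) :=
  TopologicalSpace.ofClosed {Z | ∃ T : Set (Poly n), Z = zeroSet T}
    ⟨{1}, by ext M; simp [zeroSet, evalAt]⟩
    (by
      intro A hA
      refine ⟨{P | ∃ T : Set (Poly n), zeroSet T ∈ A ∧ P ∈ T}, ?_⟩
      ext M
      constructor
      · rintro hM P ⟨T, hT, hP⟩
        exact hM _ hT P hP
      · intro hM Z hZ
        obtain ⟨T, rfl⟩ := hA hZ
        exact fun P hP => hM P ⟨T, hZ, hP⟩)
    (by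
      rintro _ ⟨T, rfl⟩ _ ⟨U, rfl⟩
      refine ⟨{R | ∃ P ∈ T, ∃ Q ∈ U, R = P * Q}, ?_⟩
      ext M
      constructor
      · rintro (h | h) _ ⟨P, hP, Q, hQ, rfl⟩
        · have := h P hP
          simp only [evalAt, map_mul] at this ⊢
          rw [this, zero_mul]
        · have := h Q hQ
          simp only [evalAt, map_mul] at this ⊢
          rw [this, mul_zero]
      · intro h
        by_contra hc
        simp only [Set.mem_union, not_or, zeroSet, Set.mem_ofPred_eq, not_forall] at hc
        obtain ⟨⟨P, hP, hP0⟩, Q, hQ, hQ0⟩ := hc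
        have := h _ ⟨P, hP, Q, hQ, rfl⟩
        simp only [evalAt, map_mul] at this hP0 hQ0
        exact (mul_ne_zero hP0 hQ0) this)

/-- The irreducible components of a set of matrices: its maximal subsets that are irreducible in
the Zariski topology. -/
def components {n : ℕ} (X : Set (Mat n)) : Set (Set (Mat n)) :=
  {Z | Maximal (fun Y : Set (Mat n) => Y ⊆ X ∧ @IsIrreducible (Mat n) (zariski n) Y) Z}

/-- The complete bipartite graph `K_{n,n}`; rows are `Sum.inl i`, columns are `Sum.inr j`. -/
abbrev bipartiteK (n : ℕ) : SimpleGraph (Fin n ⊕ Fin n) :=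
  completeBipartiteGraph (Fin n) (Fin n)

/-- The cycles of a graph, as subgraphs (neither a base point nor a direction is chosen). -/
def cycles {V : Type} (G : SimpleGraph V) : Set G.Subgraph :=
  {C | ∃ (v : V) (p : G.Walk v v), p.IsCycle ∧ C = p.toSubgraph}

/-- The binomial `∏ₐ x (i a, j a) - ∏ₐ x (i a, j (τ a))`. -/
noncomputable def binomial {n k : ℕ} (i j : Fin k → Fin n) (τ : Equiv.Perm (Fin k)) : Poly n :=
  ∏ a, MvPolynomial.X (i a, j a) - ∏ a, MvPolynomial.X (i a, j (τ a))

end Rigidity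

/-! ### Binomial hypersurfaces: primality, vanishing ideals, irreducibility. -/

section

open MvPolynomial

/-! A matrix `M` lies in the rigidity set iff some `u vᵀ` agrees with it in at least `2n` positions.
Read positions as edges of `K_{n,n}`, which has `2n` vertices: `2n` edges contain a cycle, and along
it the two alternating products of entries of `u vᵀ` coincide, so `M` kills the binomial of that
cycle (`exists_cycle_of_mem_rigiditySet`). Conversely, if `M` has no zero entry and kills the
binomial of a cycle, then `u` and `v` can be solved for around the cycle, and rescaling on connected
components enlarges the agreement to a connected graph containing the cycle, hence with at least
`2n` edges (`mem_rigiditySet_of_cycle`). The binomials are prime and the points without zero entries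
are dense in their hypersurfaces, so the closure is the union of the cycle hypersurfaces
(`borderRigidityVariety_eq_iUnion`). These are the components, and each determines its cycle
(`mem_support_of_zeroSet_subset`). -/

theorem MvPolynomial.irreducible_prod_X_sub_prod_X {σ R : Type*} [Field R]
    {S T : Finset σ} (hST : Disjoint S T) (hS : S.Nonempty) :
    Irreducible (∏ p ∈ S, X p - ∏ p ∈ T, X p : MvPolynomial σ R) := by
  classical
  obtain ⟨s, hs⟩ := hS
  have hvars : ∀ U : Finset σ, s ∉ U → s ∉ (∏ p ∈ U, X p : MvPolynomial σ R).vars := by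
    intro U hU h
    obtain ⟨p, hp, hsp⟩ := Finset.mem_biUnion.1 (vars_prod (fun p : σ => (X p : MvPolynomial σ R)) h)
    rw [vars_X, Finset.mem_singleton] at hsp
    exact hU (hsp ▸ hp)
  -- The difference is linear in `X s`, with coprime coefficients because `S` and `T` are disjoint.
  rw [← Finset.prod_erase_mul _ _ hs, sub_eq_add_neg]
  refine irreducible_mul_X_add _ _ s ?_ (hvars _ (by simp)) ?_ ?_
  · exact Finset.prod_ne_zero_iff.2 fun p _ => X_ne_zero p
  · rw [vars_neg]
    exact hvars _ (Finset.disjoint_left.1 hST hs)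
  · refine IsRelPrime.neg_right (IsRelPrime.prod_left fun p hp => IsRelPrime.prod_right fun q hq => ?_)
    refine (X_prime (i := p)).irreducible.isRelPrime_iff_not_dvd.2 fun h => ?_
    rw [X_dvd_X] at h
    subst h
    exact Finset.disjoint_left.1 hST (Finset.mem_of_mem_erase hp) hq

namespace Rigidity

variable {n : ℕ}

theorem evalAt_binomial {k : ℕ} (M : Mat n) (i j : Fin k → Fin n) (τ : Equiv.Perm (Fin k)) :
    evalAt M (binomial i j τ) = ∏ a, M (i a) (j a) - ∏ a, M (i a) (j (τ a)) := by
  simp [evalAt, binomial]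

theorem prime_binomial {k : ℕ} [NeZero k] {i j : Fin k → Fin n} (hi : Function.Injective i)
    (hj : Function.Injective j) {τ : Equiv.Perm (Fin k)} (hτ : ∀ a, τ a ≠ a) :
    Prime (binomial i j τ) := by
  refine Irreducible.prime ?_
  let φ : Fin k ↪ Fin n × Fin n := ⟨fun a => (i a, j a), fun a b h => hi (Prod.ext_iff.1 h).1⟩
  let ψ : Fin k ↪ Fin n × Fin n := ⟨fun a => (i a, j (τ a)), fun a b h => hi (Prod.ext_iff.1 h).1⟩
  have h := irreducible_prod_X_sub_prod_X (R := ℂ) (S := Finset.univ.map φ) (T := Finset.univ.map ψ)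
    (by
      refine Finset.disjoint_left.2 fun p hp hq => ?_
      simp only [Finset.mem_map, Finset.mem_univ, true_and] at hp hq
      obtain ⟨a, rfl⟩ := hp
      obtain ⟨b, hb⟩ := hq
      obtain ⟨h₁, h₂⟩ := Prod.ext_iff.1 hb
      have h₁ : b = a := hi h₁
      subst h₁
      exact hτ b (hj h₂))
    (by simp)
  rwa [Finset.prod_map, Finset.prod_map] at h

/-- Nullstellensatz over `ℂ`, applied to the prime ideal `(f)`. -/
theorem idealOf_zeroSet_of_prime {f : Poly n} (hf : Prime f) :
    idealOf (zeroSet {f}) = Ideal.span {f} := by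
  have hp : (Ideal.span {f}).IsPrime := (Ideal.span_singleton_prime hf.ne_zero).2 hf
  ext P
  rw [← IsPrime.vanishingIdeal_zeroLocus (K := ℂ) (k := ℂ) (Ideal.span {f}), mem_idealOf,
    mem_vanishingIdeal_iff, zeroLocus_span]
  constructor
  · intro h x hx
    have := h (Matrix.of fun a b => x (a, b)) (by
      rintro g rfl
      simpa [evalAt, aeval_eq_eval] using hx g rfl)
    simpa [evalAt, aeval_eq_eval] using this
  · intro h M hM
    have := h (fun p => M p.1 p.2) (by
      rintro g rfl
      simpa [evalAt, aeval_eq_eval] using hM g rfl)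
    simpa [evalAt, aeval_eq_eval] using this

theorem idealOf_anti {X Y : Set (Mat n)} (h : X ⊆ Y) : idealOf Y ≤ idealOf X := fun P hP =>
  (mem_idealOf X P).2 fun M hM => (mem_idealOf Y P).1 hP M (h hM)

/-- If the all-ones matrix lies on a hypersurface with prime equation `f`, then a polynomial that
vanishes at the points of the hypersurface without zero entries is divisible by `f`. -/
theorem dvd_of_vanish_on_torus {f : Poly n} (hf : Prime f) (h1 : evalAt (Matrix.of fun _ _ => 1) f = 0)
    {P : Poly n} (hP : ∀ M, evalAt M f = 0 → (∀ a b, M a b ≠ 0) → evalAt M P = 0) : f ∣ P := by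
  -- The monomial factor takes care of the points with a zero entry.
  have h : P * ∏ p, X p ∈ idealOf (zeroSet {f}) := by
    refine (mem_idealOf _ _).2 fun M hM => ?_
    by_cases h0 : ∀ a b, M a b ≠ 0
    · have := hP M (hM f rfl) h0
      simp only [evalAt, map_mul] at this ⊢
      rw [this, zero_mul]
    · push Not at h0
      obtain ⟨a, b, hab⟩ := h0
      simp only [evalAt, map_mul, map_prod, eval_X]
      rw [Finset.prod_eq_zero (Finset.mem_univ (a, b)) hab, mul_zero]
  rw [idealOf_zeroSet_of_prime hf, Ideal.mem_span_singleton] at h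
  -- At the all-ones matrix `f` is `0` but the monomial is `1`.
  refine (hf.dvd_or_dvd h).resolve_right ?_
  rintro ⟨g, hg⟩
  have := congrArg (evalAt (Matrix.of fun _ _ => 1)) hg
  simp only [evalAt, map_mul, map_prod, eval_X, Matrix.of_apply,
    Finset.prod_const_one] at this h1
  rw [h1, zero_mul] at this
  exact one_ne_zero this

theorem isClosed_zariski_iff {Z : Set (Mat n)} :
    @IsClosed (Mat n) (zariski n) Z ↔ ∃ T : Set (Poly n), Z = zeroSet T := by
  rw [← @isOpen_compl_iff (Mat n) Z (zariski n)]
  change (∃ T : Set (Poly n), Zᶜᶜ = zeroSet T) ↔ _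
  rw [compl_compl]

theorem isIrreducible_of_isPrime_idealOf {Z : Set (Mat n)} (hZ : (idealOf Z).IsPrime) :
    @IsIrreducible (Mat n) (zariski n) Z := by
  let t := zariski n
  refine ⟨?_, (@isPreirreducible_iff_isClosed_union_isClosed _ (zariski n) _).2 fun A B hA hB hAB => ?_⟩
  · by_contra h
    rw [Set.not_nonempty_iff_eq_empty] at h
    exact hZ.ne_top ((Ideal.eq_top_iff_one _).2 ((mem_idealOf _ _).2 (by simp [h])))
  · obtain ⟨T, rfl⟩ := isClosed_zariski_iff.1 hA
    obtain ⟨U, rfl⟩ := isClosed_zariski_iff.1 hB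
    by_contra! hc
    obtain ⟨hc₁, hc₂⟩ := hc
    obtain ⟨M, hM, hMT⟩ := Set.not_subset.1 hc₁
    obtain ⟨N, hN, hNU⟩ := Set.not_subset.1 hc₂
    simp only [zeroSet, Set.mem_ofPred_eq, not_forall] at hMT hNU
    obtain ⟨P, hP, hP0⟩ := hMT
    obtain ⟨Q, hQ, hQ0⟩ := hNU
    have hPQ : P * Q ∈ idealOf Z := by
      refine (mem_idealOf _ _).2 fun L hL => ?_
      simp only [evalAt, map_mul, mul_eq_zero]
      exact (hAB hL).imp (fun h => h P hP) fun h => h Q hQ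
    rcases hZ.mem_or_mem hPQ with h | h
    · exact hP0 ((mem_idealOf _ _).1 h M hM)
    · exact hQ0 ((mem_idealOf _ _).1 h N hN)

end Rigidity

end

/-! ### Agreement with rank-one matrices as a bipartite graph. -/

section

open SimpleGraph

/-- A forest extends to a spanning tree of the complete graph. -/
theorem SimpleGraph.IsAcyclic.natCard_edgeSet_lt {V : Type*} [Finite V] [Nonempty V]
    {G : SimpleGraph V} (hG : G.IsAcyclic) : Nat.card G.edgeSet < Nat.card V := by
  obtain ⟨T, hGT, -, hT⟩ := connected_top.exists_isTree_le_of_le_of_isAcyclic (le_top (a := G)) hG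
  have h := (isTree_iff_connected_and_card.1 hT).2
  have := Nat.card_mono (Set.toFinite T.edgeSet) (edgeSet_mono hGT)
  omega

theorem SimpleGraph.Connected.natCard_le_natCard_edgeSet {V : Type*} [Finite V]
    {G : SimpleGraph V} (hG : G.Connected) (hc : ¬ G.IsAcyclic) :
    Nat.card V ≤ Nat.card G.edgeSet := by
  have h := hG.card_vert_le_card_edgeSet_add_one
  by_contra! hlt
  exact hc (isTree_iff_connected_and_card.2 ⟨hG, by omega⟩).isAcyclic

theorem Matrix.exists_mul_of_rank_le_one {m n K : Type*} [Fintype n] [DecidableEq n] [Finite m] [Field K]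
    {A : Matrix m n K} (hA : A.rank ≤ 1) : ∃ (u : m → K) (v : n → K), ∀ i j, A i j = u i * v j := by
  cases nonempty_fintype m
  obtain ⟨u, hu⟩ := finrank_le_one_iff.1 hA
  choose c hc using fun j => hu ⟨A.mulVecLin (Pi.single j 1), LinearMap.mem_range_self ..⟩
  refine ⟨u, c, fun i j => ?_⟩
  have := congrFun (congrArg Subtype.val (hc j)) i
  simp at this
  rw [← this, mul_comm]

theorem Matrix.rank_le_one_of_mul {m n K : Type*} [Fintype n] [Finite m] [Field K]
    (u : m → K) (v : n → K) : (Matrix.of fun i j => u i * v j).rank ≤ 1 :=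
  Matrix.rank_vecMulVec_le u v

namespace Rigidity

variable {n : ℕ}

/-- The bipartite graph on rows and columns whose edges are the given positions. -/
def positionGraph (S : Set (Fin n × Fin n)) : SimpleGraph (Fin n ⊕ Fin n) :=
  fromEdgeSet ((fun p => s(Sum.inl p.1, Sum.inr p.2)) '' S)

theorem edgeSet_positionGraph (S : Set (Fin n × Fin n)) :
    (positionGraph S).edgeSet = (fun p => s(Sum.inl p.1, Sum.inr p.2)) '' S := by
  rw [positionGraph, edgeSet_fromEdgeSet, sdiff_eq_left, Set.disjoint_left]
  rintro _ ⟨p, -, rfl⟩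
  simp

theorem mk_mem_edgeSet_positionGraph {S : Set (Fin n × Fin n)} {a b : Fin n} :
    s(Sum.inl a, Sum.inr b) ∈ (positionGraph S).edgeSet ↔ (a, b) ∈ S := by
  rw [edgeSet_positionGraph]
  simp

theorem natCard_edgeSet_positionGraph (S : Set (Fin n × Fin n)) :
    Nat.card (positionGraph S).edgeSet = S.ncard := by
  rw [edgeSet_positionGraph, Nat.card_coe_set_eq, Set.ncard_image_of_injective]
  rintro ⟨a, b⟩ ⟨c, d⟩ h
  simpa using h

theorem positionGraph_le (S : Set (Fin n × Fin n)) : positionGraph S ≤ bipartiteK n := by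
  rw [← edgeSet_subset_edgeSet, edgeSet_positionGraph]
  rintro _ ⟨p, -, rfl⟩
  simp

/-- The positions where `M` agrees with the matrix `u vᵀ`. -/
def agreement (M : Mat n) (u v : Fin n → ℂ) : Set (Fin n × Fin n) :=
  {p | u p.1 * v p.2 = M p.1 p.2}

/-- Multiplying `u` by `t` and `v` by `t⁻¹` on the component of row `a₀` preserves every product
inside a component; `t` is chosen to create agreement at `(a₀, b₀)`. -/
theorem exists_rescaling {M : Mat n} (hM : ∀ a b, M a b ≠ 0) {u v : Fin n → ℂ} (hu : ∀ a, u a ≠ 0)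
    (hv : ∀ b, v b ≠ 0) {a₀ b₀ : Fin n}
    (h : ¬ (positionGraph (agreement M u v)).Reachable (Sum.inl a₀) (Sum.inr b₀)) :
    ∃ u' v' : Fin n → ℂ, (∀ a, u' a ≠ 0) ∧ (∀ b, v' b ≠ 0) ∧
      insert (a₀, b₀) (agreement M u v) ⊆ agreement M u' v' := by
  classical
  set R := (positionGraph (agreement M u v)).Reachable (Sum.inl a₀) with hR
  set t : ℂ := M a₀ b₀ / (u a₀ * v b₀) with ht
  have ht0 : t ≠ 0 := div_ne_zero (hM _ _) (mul_ne_zero (hu _) (hv _))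
  refine ⟨fun a => if R (Sum.inl a) then t * u a else u a,
    fun b => if R (Sum.inr b) then t⁻¹ * v b else v b, fun a => ?_, fun b => ?_, ?_⟩
  · dsimp only
    split_ifs
    exacts [mul_ne_zero ht0 (hu a), hu a]
  · dsimp only
    split_ifs
    exacts [mul_ne_zero (inv_ne_zero ht0) (hv b), hv b]
  · rintro ⟨a, b⟩ (hab | hab)
    · obtain ⟨rfl, rfl⟩ := Prod.ext_iff.1 hab
      have h₀ : R (Sum.inl a) := Reachable.refl _
      have hua := hu a
      have hvb := hv b
      simp only [agreement, Set.mem_ofPred_eq, if_pos h₀, if_neg h, ht]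
      field_simp
    · have hadj : (positionGraph (agreement M u v)).Adj (Sum.inl a) (Sum.inr b) :=
        mk_mem_edgeSet_positionGraph.2 hab
      have hiff : R (Sum.inl a) ↔ R (Sum.inr b) :=
        ⟨fun h => h.trans hadj.reachable, fun h => h.trans hadj.symm.reachable⟩
      simp only [agreement, Set.mem_ofPred_eq] at hab ⊢
      by_cases hb : R (Sum.inr b)
      · rw [if_pos (hiff.2 hb), if_pos hb, ← hab]
        field_simp
      · rw [if_neg (mt hiff.1 hb), if_neg hb, hab]

/-- Take a maximal agreement set among nowhere zero `u`, `v`; were it disconnected,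
`exists_rescaling` would enlarge it. -/
theorem exists_connected_agreement [NeZero n] {M : Mat n} (hM : ∀ a b, M a b ≠ 0) {u v : Fin n → ℂ}
    (hu : ∀ a, u a ≠ 0) (hv : ∀ b, v b ≠ 0) :
    ∃ u' v' : Fin n → ℂ, agreement M u v ⊆ agreement M u' v' ∧
      (positionGraph (agreement M u' v')).Connected := by
  obtain ⟨S, hS, hmax⟩ := Set.Finite.exists_le_maximal
    (s := {S | ∃ u v : Fin n → ℂ, (∀ a, u a ≠ 0) ∧ (∀ b, v b ≠ 0) ∧ S = agreement M u v})
    (Set.toFinite _) ⟨u, v, hu, hv, rfl⟩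
  obtain ⟨u', v', hu', hv', rfl⟩ := hmax.prop
  refine ⟨u', v', hS, ?_⟩
  have key : ∀ a b, (positionGraph (agreement M u' v')).Reachable (Sum.inl a) (Sum.inr b) := by
    intro a b
    by_contra h
    obtain ⟨u₂, v₂, hu₂, hv₂, hsub⟩ := exists_rescaling hM hu' hv' h
    have hle := hmax.le_of_ge ⟨u₂, v₂, hu₂, hv₂, rfl⟩ ((Set.subset_insert _ _).trans hsub)
    have hadj : (positionGraph (agreement M u' v')).Adj (Sum.inl a) (Sum.inr b) :=
      mk_mem_edgeSet_positionGraph.2 (hle (hsub (Set.mem_insert _ _)))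
    exact h hadj.reachable
  have : Nonempty (Fin n ⊕ Fin n) := ⟨Sum.inl 0⟩
  refine ⟨?_⟩
  rintro (a | a) (b | b)
  · exact (key a 0).trans (key b 0).symm
  · exact key a b
  · exact (key b a).symm
  · exact (key 0 a).symm.trans (key 0 b)

/-- Partial products solve the recursion; `hprod` is the condition for closing up at the last index.
-/
theorem _root_.exists_finRotate_eq_mul {k : ℕ} {r : Fin (k + 1) → ℂ} (hr : ∀ a, r a ≠ 0)
    (hprod : ∏ a, r a = 1) :
    ∃ w : Fin (k + 1) → ℂ, (∀ a, w a ≠ 0) ∧ ∀ a, w (finRotate _ a) = w a * r a := by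
  refine ⟨fun a => ∏ b ∈ Finset.Iio a, r b, fun a => Finset.prod_ne_zero_iff.2 fun b _ => hr b,
    fun a => ?_⟩
  rw [mul_comm, ← Finset.prod_insert (by simp), Finset.Iio_insert]
  rcases eq_or_ne a (Fin.last k) with rfl | h
  · rw [finRotate_last, show Finset.Iic (Fin.last k) = Finset.univ by ext; simp [Fin.le_last], hprod]
    exact Finset.prod_eq_one fun b hb => absurd (Finset.mem_Iio.1 hb) (Fin.not_lt_zero b)
  · refine Finset.prod_congr (Finset.ext fun b => ?_) fun _ _ => rfl
    rw [Finset.mem_Iio, Finset.mem_Iic, Fin.lt_def, Fin.le_def, coe_finRotate_of_ne_last h]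
    omega

theorem exists_agreement_of_evalAt_binomial {k : ℕ} {M : Mat n} (hM : ∀ a b, M a b ≠ 0)
    {i j : Fin (k + 1) → Fin n} (hi : Function.Injective i) (hj : Function.Injective j)
    (h : evalAt M (binomial i j (finRotate _)) = 0) :
    ∃ u v : Fin n → ℂ, (∀ a, u a ≠ 0) ∧ (∀ b, v b ≠ 0) ∧
      ∀ a, (i a, j a) ∈ agreement M u v ∧ (i a, j (finRotate _ a)) ∈ agreement M u v := by
  obtain ⟨w, hw0, hw⟩ := exists_finRotate_eq_mul
    -- Agreement on both edges at row `i a` forces this ratio between consecutive values of `v`; the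
    -- binomial says that the ratios multiply to `1`.
    (r := fun a => M (i a) (j (finRotate _ a)) / M (i a) (j a))
    (fun a => div_ne_zero (hM _ _) (hM _ _)) (by
      simp only [evalAt, binomial, map_sub, map_prod, MvPolynomial.eval_X, sub_eq_zero] at h
      rw [Finset.prod_div_distrib, ← h]
      exact div_self (Finset.prod_ne_zero_iff.2 fun a _ => hM _ _))
  -- Off the cycle any nonzero value would do; the default is `1`.
  refine ⟨Function.extend i (fun a => M (i a) (j a) / w a) 1, Function.extend j w 1,
    fun a => ?_, fun b => ?_, fun a => ?_⟩
  · by_cases ha : ∃ c, i c = a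
    · obtain ⟨c, rfl⟩ := ha
      rw [hi.extend_apply]
      exact div_ne_zero (hM _ _) (hw0 _)
    · rw [Function.extend_apply' _ _ _ ha]
      exact one_ne_zero
  · by_cases hb : ∃ c, j c = b
    · obtain ⟨c, rfl⟩ := hb
      rw [hj.extend_apply]
      exact hw0 _
    · rw [Function.extend_apply' _ _ _ hb]
      exact one_ne_zero
  · have h₁ := hw0 a
    have h₂ := hM (i a) (j a)
    simp only [agreement, Set.mem_ofPred_eq, hi.extend_apply, hj.extend_apply, hw]
    constructor <;> field_simp

end Rigidity

end

/-! ### Cycles of `K_{n,n}`, rigidity as agreement, components. -/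

section

open SimpleGraph

namespace Rigidity

variable {n : ℕ}

theorem isLeft_eq_not_of_adj {x y : Fin n ⊕ Fin n} (h : (bipartiteK n).Adj x y) :
    x.isLeft = !y.isLeft := by
  rcases x with x | x <;> rcases y with y | y <;> simp_all

theorem isLeft_getVert {b : Fin n} {v : Fin n ⊕ Fin n} (p : (bipartiteK n).Walk (Sum.inr b) v) :
    ∀ t ≤ p.length, (p.getVert t).isLeft = decide (Odd t)
  | 0, _ => by simp
  | t + 1, ht => by
    have h := isLeft_getVert p t (by omega)
    rw [isLeft_eq_not_of_adj (p.adj_getVert_succ (by omega))] at h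
    rw [← Bool.not_not ((p.getVert (t + 1)).isLeft), h, ← decide_not, decide_eq_decide,
      Nat.odd_add_one]

theorem exists_isCycle_inr {C : (bipartiteK n).Subgraph} (hC : C ∈ cycles (bipartiteK n)) :
    ∃ (b : Fin n) (p : (bipartiteK n).Walk (Sum.inr b) (Sum.inr b)), p.IsCycle ∧
      C = p.toSubgraph := by
  classical
  obtain ⟨v, p, hp, rfl⟩ := hC
  rcases v with a | b
  · have hlen := hp.three_le_length
    have hadj := p.adj_getVert_succ (i := 0) (by omega)
    obtain ⟨b, hb⟩ : ∃ b, p.getVert 1 = Sum.inr b := by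
      rw [Walk.getVert_zero] at hadj
      rcases h : p.getVert 1 with c | c
      · simp [h] at hadj
      · exact ⟨c, rfl⟩
    have hmem : Sum.inr b ∈ p.support := hb ▸ p.getVert_mem_support 1
    exact ⟨b, p.rotate _ hmem, hp.rotate hmem, (p.toSubgraph_rotate hmem).symm⟩
  · exact ⟨b, p, hp, rfl⟩

/-- A cycle of `K_{n,n}` passes alternately through columns `j 0, j 1, …` and rows `i 0, i 1, …`. -/
theorem exists_cyclic_enumeration {C : (bipartiteK n).Subgraph} (hC : C ∈ cycles (bipartiteK n)) :
    ∃ (m : ℕ) (i j : Fin (m + 2) → Fin n), Function.Injective i ∧ Function.Injective j ∧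
      C.edgeSet = {d | ∃ a, d = s(Sum.inl (i a), Sum.inr (j a)) ∨
        d = s(Sum.inl (i a), Sum.inr (j (finRotate _ a)))} := by
  obtain ⟨b, p, hp, rfl⟩ := exists_isCycle_inr hC
  have h3 := hp.three_le_length
  have heven : Even p.length := by
    have := isLeft_getVert p p.length le_rfl
    simpa using this
  -- An even length that is at least `3` is at least `4`.
  obtain ⟨m, hm⟩ : ∃ m, p.length = 2 * (m + 2) := by
    obtain ⟨l, hl⟩ := heven
    exact ⟨l - 2, by omega⟩
  have hj : ∀ a : Fin (m + 2), ∃ c, p.getVert (2 * a) = Sum.inr c := by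
    intro a
    have := isLeft_getVert p (2 * a) (by omega)
    rcases h : p.getVert (2 * a) with c | c
    · simp [h, Nat.odd_iff] at this
    · exact ⟨c, rfl⟩
  have hi : ∀ a : Fin (m + 2), ∃ c, p.getVert (2 * a + 1) = Sum.inl c := by
    intro a
    have := isLeft_getVert p (2 * a + 1) (by omega)
    rcases h : p.getVert (2 * a + 1) with c | c
    · exact ⟨c, rfl⟩
    · simp [h] at this
  choose j hj using hj
  choose i hi using hi
  have hrot : ∀ a : Fin (m + 2), p.getVert (2 * a + 2) = Sum.inr (j (finRotate _ a)) := by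
    intro a
    rcases eq_or_ne a (Fin.last _) with rfl | h
    · rw [finRotate_last, ← hj, Fin.val_last, Fin.val_zero, mul_zero, Walk.getVert_zero,
        show 2 * (m + 1) + 2 = p.length by omega, Walk.getVert_length]
    · rw [← hj, coe_finRotate_of_ne_last h]
      rfl
  have hinj := hp.getVert_injOn'
  refine ⟨m, i, j, fun a a' h => ?_, fun a a' h => ?_, ?_⟩
  · have := hinj (by simp only [Set.mem_ofPred_eq]; omega) (by simp only [Set.mem_ofPred_eq]; omega)
      ((hi a).trans ((congrArg _ h).trans (hi a').symm))
    exact Fin.ext (by omega)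
  · have := hinj (by simp only [Set.mem_ofPred_eq]; omega) (by simp only [Set.mem_ofPred_eq]; omega)
      ((hj a).trans ((congrArg _ h).trans (hj a').symm))
    exact Fin.ext (by omega)
  · ext d
    induction d with | _ x y
    rw [Subgraph.mem_edgeSet, Walk.toSubgraph_adj_iff, Set.mem_ofPred_eq]
    constructor
    · rintro ⟨t, ht, htl⟩
      obtain ⟨l, rfl | rfl⟩ := t.even_or_odd'
      · refine ⟨⟨l, by omega⟩, Or.inl ?_⟩
        rw [← ht, ← hi, ← hj, Sym2.eq_swap]
      · refine ⟨⟨l, by omega⟩, Or.inr ?_⟩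
        rw [← ht, ← hi, ← hrot]
    · rintro ⟨a, h | h⟩
      · exact ⟨2 * a, by rw [h, ← hi, ← hj, Sym2.eq_swap], by omega⟩
      · exact ⟨2 * a + 1, by rw [h, ← hi, ← hrot], by omega⟩

/-- A subgraph could have isolated vertices, but every vertex of a cycle lies on an edge. -/
theorem eq_of_edgeSet_eq {C D : (bipartiteK n).Subgraph} (hC : C ∈ cycles (bipartiteK n))
    (hD : D ∈ cycles (bipartiteK n)) (h : C.edgeSet = D.edgeSet) : C = D := by
  have key : ∀ {C : (bipartiteK n).Subgraph}, C ∈ cycles (bipartiteK n) →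
      ∀ x, x ∈ C.verts ↔ ∃ y, C.Adj x y := by
    rintro C ⟨v, p, hp, rfl⟩ x
    refine ⟨fun hx => ?_, fun ⟨y, hy⟩ => p.toSubgraph.edge_vert hy⟩
    rw [Walk.mem_verts_toSubgraph,
      Walk.mem_support_iff_exists_mem_edges_of_not_nil hp.not_nil] at hx
    obtain ⟨e, he, hxe⟩ := hx
    obtain ⟨y, rfl⟩ := hxe
    exact ⟨y, (Walk.mem_edges_toSubgraph p).2 he⟩
  have hadj : C.Adj = D.Adj := by
    ext x y
    rw [← Subgraph.mem_edgeSet, h, Subgraph.mem_edgeSet]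
  refine Subgraph.ext (Set.ext fun x => ?_) hadj
  rw [key hC, key hD, hadj]

theorem rig_le_iff {r s : ℕ} {M : Mat n} : rig r M ≤ s ↔ ∃ t ≤ s, HasDecomposition r M t :=
  ⟨fun h => ⟨_, h, Nat.sInf_mem (exists_hasDecomposition r M)⟩,
    fun ⟨_, ht, h⟩ => (Nat.sInf_le h).trans ht⟩

theorem ncard_agreement_add (M : Mat n) (u v : Fin n → ℂ) :
    (agreement M u v).ncard + {p : Fin n × Fin n | M p.1 p.2 - u p.1 * v p.2 ≠ 0}.ncard = n ^ 2 := by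
  have : {p : Fin n × Fin n | M p.1 p.2 - u p.1 * v p.2 ≠ 0} = (agreement M u v)ᶜ := by
    ext p
    simp [agreement, sub_eq_zero, eq_comm]
  rw [this, Set.ncard_add_ncard_compl]
  simp [sq]

theorem mem_rigiditySet_one_iff {s : ℕ} {M : Mat n} :
    M ∈ rigiditySet n 1 s ↔ ∃ u v : Fin n → ℂ, n ^ 2 ≤ (agreement M u v).ncard + s := by
  rw [rigiditySet, Set.mem_ofPred_eq, rig_le_iff]
  constructor
  · rintro ⟨t, ht, A, B, rfl, hA, rfl⟩
    obtain ⟨u, v, huv⟩ := Matrix.exists_mul_of_rank_le_one hA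
    refine ⟨u, v, ?_⟩
    have := ncard_agreement_add (A + B) u v
    simp only [Matrix.add_apply, huv, add_sub_cancel_left] at this
    omega
  · rintro ⟨u, v, h⟩
    have := ncard_agreement_add M u v
    exact ⟨{p : Fin n × Fin n | M p.1 p.2 - u p.1 * v p.2 ≠ 0}.ncard, by omega, Matrix.of fun a b => u a * v b, M - Matrix.of fun a b => u a * v b,
      by simp, Matrix.rank_le_one_of_mul u v, rfl⟩

theorem not_isAcyclic_positionGraph_iff {S : Set (Fin n × Fin n)} : ¬ (positionGraph S).IsAcyclic ↔
    ∃ C ∈ cycles (bipartiteK n), C.edgeSet ⊆ (positionGraph S).edgeSet := by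
  constructor
  · intro h
    simp only [IsAcyclic, not_forall, not_not] at h
    obtain ⟨v, p, hp⟩ := h
    refine ⟨_, ⟨v, p.mapLe (positionGraph_le S), hp.mapLe _, rfl⟩, fun e he => ?_⟩
    rw [Walk.mem_edges_toSubgraph, Walk.edges_mapLe_eq_edges] at he
    exact p.edges_subset_edgeSet he
  · rintro ⟨C, ⟨v, p, hp, rfl⟩, h⟩ hac
    have h' : ∀ e ∈ p.edges, e ∈ (positionGraph S).edgeSet := fun e he =>
      h ((Walk.mem_edges_toSubgraph p).2 he)
    exact hac _ (hp.transfer h')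

theorem evalAt_binomial_of_mem_agreement {k : ℕ} {M : Mat n} {u v : Fin n → ℂ}
    {i j : Fin k → Fin n} {τ : Equiv.Perm (Fin k)} (h₁ : ∀ a, (i a, j a) ∈ agreement M u v)
    (h₂ : ∀ a, (i a, j (τ a)) ∈ agreement M u v) : evalAt M (binomial i j τ) = 0 := by
  have h₁' : ∀ a, M (i a) (j a) = u (i a) * v (j a) := fun a => (h₁ a).symm
  have h₂' : ∀ a, M (i a) (j (τ a)) = u (i a) * v (j (τ a)) := fun a => (h₂ a).symm
  rw [evalAt_binomial]
  simp only [h₁', h₂', Finset.prod_mul_distrib]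
  rw [Equiv.prod_comp τ fun a => v (j a), sub_self]

/-- The irreducible components of a finite union of hypersurfaces with prime equations. -/
theorem mem_components_iff {ι : Type*} [Finite ι] {f : ι → Poly n} (hf : ∀ c, Prime (f c))
    {Z : Set (Mat n)} : Z ∈ components (⋃ c, zeroSet {f c}) ↔ ∃ c, Z = zeroSet {f c} := by
  have hsub : ∀ {Y : Set (Mat n)}, @IsIrreducible _ (zariski n) Y → Y ⊆ ⋃ c, zeroSet {f c} →
      ∃ c, Y ⊆ zeroSet {f c} := by
    classical
    intro Y hY hYX
    obtain ⟨_, hz, h⟩ := (@isIrreducible_iff_sUnion_isClosed _ (zariski n) Y).1 hY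
      (Set.finite_range fun c => zeroSet {f c}).toFinset
      (by
        intro z hz
        obtain ⟨c, rfl⟩ := (Set.Finite.mem_toFinset _).1 hz
        exact isClosed_zariski_iff.2 ⟨_, rfl⟩)
      (by simpa [Set.sUnion_range] using hYX)
    obtain ⟨c, rfl⟩ := (Set.Finite.mem_toFinset _).1 hz
    exact ⟨c, h⟩
  have hirr : ∀ c, @IsIrreducible _ (zariski n) (zeroSet {f c}) := fun c =>
    isIrreducible_of_isPrime_idealOf <| by
      rw [idealOf_zeroSet_of_prime (hf c)]
      exact (Ideal.span_singleton_prime (hf c).ne_zero).2 (hf c)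
  rw [components, Set.mem_ofPred_eq]
  constructor
  · intro hZ
    obtain ⟨c, hc⟩ := hsub hZ.prop.2 hZ.prop.1
    exact ⟨c, hc.antisymm (hZ.2 ⟨Set.subset_iUnion (fun c => zeroSet {f c}) c, hirr c⟩ hc)⟩
  · rintro ⟨c, rfl⟩
    refine ⟨⟨Set.subset_iUnion (fun c => zeroSet {f c}) c, hirr c⟩, fun Y hY hle => ?_⟩
    obtain ⟨d, hd⟩ := hsub hY.2 hY.1
    -- Nested hypersurfaces give divisibility between primes, hence associates with the same zero
    -- set.
    have h := idealOf_anti (hle.trans hd)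
    rw [idealOf_zeroSet_of_prime (hf c), idealOf_zeroSet_of_prime (hf d),
      Ideal.span_singleton_le_span_singleton] at h
    obtain ⟨g, hg⟩ := ((hf c).associated_of_dvd (hf d) h).symm.dvd
    refine hd.trans fun M hM => ?_
    rintro _ rfl
    have := hM (f d) rfl
    simp only [evalAt] at this ⊢
    rw [hg, map_mul, this, zero_mul]

end Rigidity

end

/-! ### The border rigidity variety as a union of cycle hypersurfaces. -/

namespace Rigidity

variable {n : ℕ}

theorem evalAt_one_binomial {k : ℕ} (i j : Fin k → Fin n) (τ : Equiv.Perm (Fin k)) :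
    evalAt (Matrix.of fun _ _ => 1) (binomial i j τ) = 0 := by
  simp [evalAt_binomial]

/-- A hypersurface containment between cyclic binomials forces a containment of their supports. -/
theorem mem_support_of_zeroSet_subset {k l : ℕ} {i j : Fin k → Fin n} {i' j' : Fin l → Fin n}
    {τ : Equiv.Perm (Fin k)} {σ : Equiv.Perm (Fin l)} (hi : Function.Injective i)
    (hj : Function.Injective j) (hτ : ∀ a, τ a ≠ a)
    (h : zeroSet {binomial i' j' σ} ⊆ zeroSet {binomial i j τ}) {x y : Fin n}
    (hxy : ∃ a, x = i a ∧ (y = j a ∨ y = j (τ a))) :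
    ∃ a, x = i' a ∧ (y = j' a ∨ y = j' (σ a)) := by
  classical
  by_contra! hc
  -- A single zero at `(x, y)` among ones: a binomial not involving that position evaluates to `1 -
  -- 1`, one involving it in exactly one monomial to `±1`.
  have h₁ : (Matrix.of fun a b => if a = x ∧ b = y then 0 else 1 : Mat n) ∈ zeroSet {binomial i' j' σ} := by
    rintro _ rfl
    rw [evalAt_binomial, Finset.prod_eq_one, Finset.prod_eq_one, sub_self] <;>
      simp only [Matrix.of_apply]
    · exact fun a _ => if_neg fun ⟨h₁, h₂⟩ => (hc a h₁.symm).2 h₂.symm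
    · exact fun a _ => if_neg fun ⟨h₁, h₂⟩ => (hc a h₁.symm).1 h₂.symm
  have h₂ := h h₁ _ rfl
  rw [evalAt_binomial] at h₂
  simp only [Matrix.of_apply] at h₂
  obtain ⟨a, rfl, rfl | rfl⟩ := hxy
  · rw [Finset.prod_eq_zero (Finset.mem_univ a) (by simp), Finset.prod_eq_one] at h₂
    · simp at h₂
    · refine fun b _ => if_neg fun ⟨h₁, h₂⟩ => ?_
      obtain rfl := hi h₁
      exact hτ b (hj h₂)
  · rw [Finset.prod_eq_zero (s := Finset.univ) (f := fun b => ite (i b = i a ∧ j (τ b) = j (τ a)) _ _)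
      (Finset.mem_univ a) (by simp), Finset.prod_eq_one] at h₂
    · simp at h₂
    · refine fun b _ => if_neg fun ⟨h₁, h₂⟩ => ?_
      obtain rfl := hi h₁
      exact hτ b (hj h₂).symm

theorem exists_cycle_of_mem_rigiditySet (hn : 2 ≤ n) {M : Mat n}
    (hM : M ∈ rigiditySet n 1 (n ^ 2 - 2 * n)) : ∃ C ∈ cycles (bipartiteK n), ∃ u v : Fin n → ℂ,
      C.edgeSet ⊆ (positionGraph (agreement M u v)).edgeSet := by
  obtain ⟨u, v, h⟩ := mem_rigiditySet_one_iff.1 hM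
  -- The natural subtraction `n ^ 2 - 2 * n` is not truncated, so the agreement has at least `2 * n`
  -- edges.
  have h2n : 2 * n ≤ n ^ 2 := by nlinarith
  have : Nonempty (Fin n ⊕ Fin n) := ⟨Sum.inl ⟨0, by omega⟩⟩
  obtain ⟨C, hC, hsub⟩ := not_isAcyclic_positionGraph_iff.1 fun hac => by
    have := hac.natCard_edgeSet_lt (G := positionGraph (agreement M u v))
    rw [natCard_edgeSet_positionGraph] at this
    simp only [Nat.card_eq_fintype_card, Fintype.card_sum, Fintype.card_fin] at this
    omega
  exact ⟨C, hC, u, v, hsub⟩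

theorem mem_rigiditySet_of_cycle [NeZero n] {M : Mat n} (hM : ∀ a b, M a b ≠ 0)
    {C : (bipartiteK n).Subgraph} (hC : C ∈ cycles (bipartiteK n)) {u v : Fin n → ℂ}
    (hu : ∀ a, u a ≠ 0) (hv : ∀ b, v b ≠ 0)
    (hsub : C.edgeSet ⊆ (positionGraph (agreement M u v)).edgeSet) :
    M ∈ rigiditySet n 1 (n ^ 2 - 2 * n) := by
  obtain ⟨u', v', hle, hconn⟩ := exists_connected_agreement hM hu hv
  have hc : ¬ (positionGraph (agreement M u' v')).IsAcyclic := by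
    refine not_isAcyclic_positionGraph_iff.2 ⟨C, hC, hsub.trans ?_⟩
    rw [edgeSet_positionGraph, edgeSet_positionGraph]
    exact Set.image_mono hle
  have h := hconn.natCard_le_natCard_edgeSet hc
  rw [natCard_edgeSet_positionGraph] at h
  simp only [Nat.card_eq_fintype_card, Fintype.card_sum, Fintype.card_fin] at h
  exact mem_rigiditySet_one_iff.2 ⟨u', v', by omega⟩

/-- The product of all `f c` vanishes on the rigidity set; conversely, any polynomial vanishing
there is divisible by each `f c`, by `dvd_of_vanish_on_torus`. -/
theorem borderRigidityVariety_eq_iUnion {s : ℕ} {ι : Type*} [Finite ι] {f : ι → Poly n}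
    (hf : ∀ c, Prime (f c)) (h1 : ∀ c, evalAt (Matrix.of fun _ _ => 1) (f c) = 0)
    (hsub : ∀ M ∈ rigiditySet n 1 s, ∃ c, evalAt M (f c) = 0)
    (hsup : ∀ c M, (∀ a b, M a b ≠ 0) → evalAt M (f c) = 0 → M ∈ rigiditySet n 1 s) :
    borderRigidityVariety n 1 s = ⋃ c, zeroSet {f c} := by
  cases nonempty_fintype ι
  ext M
  rw [Set.mem_iUnion]
  constructor
  · intro hM
    have h := hM (∏ c, f c) ((mem_idealOf _ _).2 fun N hN => by
      obtain ⟨c, hc⟩ := hsub N hN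
      rw [evalAt, map_prod]
      exact Finset.prod_eq_zero (Finset.mem_univ c) hc)
    rw [evalAt, map_prod, Finset.prod_eq_zero_iff] at h
    obtain ⟨c, -, hc⟩ := h
    refine ⟨c, ?_⟩
    rintro _ rfl
    exact hc
  · rintro ⟨c, hc⟩ P hP
    obtain ⟨Q, rfl⟩ := dvd_of_vanish_on_torus (hf c) (h1 c) fun N hN hN0 =>
      (mem_idealOf _ P).1 hP N (hsup c N hN0 hN)
    have := hc (f c) rfl
    rw [evalAt] at this ⊢
    rw [map_mul, this, zero_mul]

end Rigidity

open Rigidity in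
theorem mainTheorem6 (n : ℕ) (hn : 2 ≤ n) :
    ∃ e : Rigidity.cycles (Rigidity.bipartiteK n) ≃
        Rigidity.components (Rigidity.borderRigidityVariety n 1 (n ^ 2 - 2 * n)),
      ∀ C : Rigidity.cycles (Rigidity.bipartiteK n),
        ∃ (k : ℕ) (i j : Fin k → Fin n) (τ : Equiv.Perm (Fin k)),
          Function.Injective i ∧ Function.Injective j ∧
          τ.IsCycle ∧ τ.support = Finset.univ ∧
          C.1.edgeSet =
            {d | ∃ a : Fin k, d = s(Sum.inl (i a), Sum.inr (j a)) ∨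
              d = s(Sum.inl (i a), Sum.inr (j (τ a)))} ∧
          Rigidity.idealOf (e C).1 = Ideal.span {Rigidity.binomial i j τ} := by
  have : NeZero n := ⟨by omega⟩
  choose m i j hi hj hE using fun C : cycles (bipartiteK n) => exists_cyclic_enumeration C.2
  have hrot : ∀ m (a : Fin (m + 2)), finRotate _ a ≠ a := fun m a =>
    Equiv.Perm.mem_support.1 (support_finRotate ▸ Finset.mem_univ a)
  let f : cycles (bipartiteK n) → Poly n := fun C => binomial (i C) (j C) (finRotate _)
  have hf : ∀ C, Prime (f C) := fun C => prime_binomial (hi C) (hj C) (hrot _)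
  have hX : borderRigidityVariety n 1 (n ^ 2 - 2 * n) = ⋃ C, zeroSet {f C} := by
    refine borderRigidityVariety_eq_iUnion hf (fun C => evalAt_one_binomial ..) ?_ ?_
    · intro M hM
      obtain ⟨C, hC, u, v, hsub⟩ := exists_cycle_of_mem_rigiditySet hn hM
      rw [hE ⟨C, hC⟩] at hsub
      exact ⟨⟨C, hC⟩, evalAt_binomial_of_mem_agreement
        (fun a => mk_mem_edgeSet_positionGraph.1 (hsub ⟨a, Or.inl rfl⟩))
        fun a => mk_mem_edgeSet_positionGraph.1 (hsub ⟨a, Or.inr rfl⟩)⟩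
    · intro C M hM h
      obtain ⟨u, v, hu, hv, huv⟩ := exists_agreement_of_evalAt_binomial hM (hi C) (hj C) h
      refine mem_rigiditySet_of_cycle hM C.2 hu hv ?_
      rw [hE C]
      rintro _ ⟨a, rfl | rfl⟩
      · exact mk_mem_edgeSet_positionGraph.2 (huv a).1
      · exact mk_mem_edgeSet_positionGraph.2 (huv a).2
  -- Equal hypersurfaces thus come from equal edge sets, which gives injectivity.
  have hle : ∀ C D, zeroSet {f D} ⊆ zeroSet {f C} → C.1.edgeSet ⊆ D.1.edgeSet := by
    intro C D h
    rw [hE C, hE D]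
    rintro _ ⟨a, ha⟩
    obtain ⟨y, rfl, hy⟩ : ∃ y, _ = s(Sum.inl (i C a), Sum.inr y) ∧
        (y = j C a ∨ y = j C (finRotate _ a)) :=
      ha.elim (fun h => ⟨_, h, Or.inl rfl⟩) fun h => ⟨_, h, Or.inr rfl⟩
    obtain ⟨b, hx, hy⟩ := mem_support_of_zeroSet_subset (hi C) (hj C) (hrot _) h ⟨a, rfl, hy⟩
    exact ⟨b, by rw [hx]; exact hy.imp (fun h => by rw [h]) fun h => by rw [h]⟩
  let φ : cycles (bipartiteK n) → components (borderRigidityVariety n 1 (n ^ 2 - 2 * n)) :=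
    fun C => ⟨zeroSet {f C}, hX ▸ (mem_components_iff hf).2 ⟨C, rfl⟩⟩
  have hφ : Function.Bijective φ := by
    refine ⟨fun C D h => ?_, fun ⟨Z, hZ⟩ => ?_⟩
    · have h : zeroSet {f C} = zeroSet {f D} := congrArg Subtype.val h
      exact Subtype.ext (eq_of_edgeSet_eq C.2 D.2 ((hle C D h.ge).antisymm (hle D C h.le)))
    · have hZ' := hZ
      rw [hX, mem_components_iff hf] at hZ'
      obtain ⟨C, hC⟩ := hZ'
      exact ⟨C, Subtype.ext hC.symm⟩
  exact ⟨Equiv.ofBijective φ hφ, fun C => ⟨m C + 2, i C, j C, finRotate _, hi C, hj C,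
    isCycle_finRotate, support_finRotate, hE C, idealOf_zeroSet_of_prime (hf C)⟩⟩
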